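/- Let $p\ge 2$ and $k\ge 1$, and let $F$ be a germ of biholomorphism of $\mathbb C^p$ fixing $0$, tangent to the identity and of order $k+1$; that is, $F(z)=z+P_{k+1}(z)+O(\|z\|^{k+2})$ with $P_{k+1}\not\equiv 0$ homogeneous of degree $k+1$. Let $v\in\mathbb C^p\setminus\{0\}$ span a non-degenerate characteristic direction: $P_{k+1}(v)=\lambda v$ with $\lambda\in\mathbb C\setminus\{0\}$. After reordering the coordinates we have $[v]=[1:u_0]\in\mathbb{CP}^{p-1}$ with $u_0\in\mathbb C^{p-1}$. Write $P_{k+1}=(p_{k+1},q_{k+1})$ with values in $\mathbb C\times\mathbb C^{p-1}$, put $r(u)=q_{k+1}(1,u)-p_{k+1}(1,u)\,u$, and let $$A(v)=\frac{1}{k\,p_{k+1}(1,u_0)}\,r'(u_0).$$ The eigenvalues of this $(p-1)\times(p-1)$ matrix are the directors of $[v]$. Suppose that $[v]$ is attracting: all its directors have strictly positive real part. Then, for every neighbourhood $U$ of $0$, there are $k$ pairwise disjoint sets $D_1,\dots,D_k\subset U$ and $k$ distinct complex numbers $\zeta_1,\dots,\zeta_k$ with $\zeta_i^k=-\frac{1}{k\lambda}$,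 such that for each $i$: 1. $D_i$ is a nonempty connected open set with $0\in\partial D_i$ and $F(D_i)\subset D_i$. 2. For every $z\in D_i$ the orbit $X_n=F^n(z)$ satisfies $X_n\ne 0$ for all $n$, $X_n\to 0$, and $[X_n]\to[v]$ in $\mathbb{CP}^{p-1}$. 3. For every $z\in D_i$ and every linear form $x\colon\mathbb C^p\to\mathbb C$ normalised by $x(v)^k=-k\lambda$, the sequence $x_n=x(F^n(z))$ satisfies $x_n^k\sim\frac1n$, that is, $n\,x_n^k\to 1$. 4. For every $z\in D_i$ we have $n^{1/k}F^n(z)\to\zeta_i v$. Thus the $k$ domains belong to the $k$ different real attracting directions $\zeta_i v$ in the complex line $\mathbb C v$. -/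

import Mathlib

open Filter Topology Asymptotics
open scoped LinearAlgebra.Projectivization

noncomputable section

namespace ParabolicGerm

/-- The space `ℂ^p` with its Euclidean norm. -/
abbrev Cp (p : ℕ) : Type := EuclideanSpace ℂ (Fin p)

variable {p : ℕ}

/-- The homogeneous term of degree `m` in the expansion at the origin
`F = ∑ P_m` of a map which is holomorphic near the origin:
`P_m(z) = D^m F(0)(z, …, z) / m!`. -/
def homTerm (F : Cp p → Cp p) (m : ℕ) (z : Cp p) : Cp p :=
  ((m.factorial : ℂ)⁻¹) • iteratedFDeriv ℂ m F 0 (fun _ => z)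

/-- The homogeneous terms are the diagonal values of any power series expansion. -/
theorem homTerm_eq {F : Cp p → Cp p} {φ : FormalMultilinearSeries ℂ (Cp p) (Cp p)}
    (h : HasFPowerSeriesAt F φ 0) (m : ℕ) (z : Cp p) :
    homTerm F m z = φ m (fun _ => z) := by
  obtain ⟨r, hr⟩ := h
  have h1 := hr.factorial_smul z m
  have h0 : (m.factorial : ℂ) ≠ 0 := by exact_mod_cast m.factorial_ne_zero
  rw [homTerm, ← h1, ← Nat.cast_smul_eq_nsmul ℂ, smul_smul, inv_mul_cancel₀ h0, one_smul]

/-- `F` represents a germ of biholomorphism of `ℂ^p` fixing the origin and tangent to the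
identity. Only the values of `F` near `0` are relevant; local invertibility is automatic,
by the inverse function theorem, because the differential at `0` is the identity. -/
structure IsTangentToIdentity (F : Cp p → Cp p) : Prop where
  analyticAt : AnalyticAt ℂ F 0
  map_zero : F 0 = 0
  fderiv_eq : fderiv ℂ F 0 = ContinuousLinearMap.id ℂ (Cp p)

/-- The order of `F` is `ν`: the minimum of the `ν ≥ 2` with `P_ν ≢ 0`. -/
def HasOrder (F : Cp p → Cp p) (ν : ℕ) : Prop :=
  IsLeast {m : ℕ | 2 ≤ m ∧ homTerm F m ≠ 0} ν

/-- `v` spans a non-degenerate characteristic direction of a germ `F` of order `k + 1`: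
`v ≠ 0`, `P_{k+1}(v) ∈ ℂ v` and `P_{k+1}(v) ≠ 0`. -/
structure IsNondegCharDirection (F : Cp p → Cp p) (k : ℕ) (v : Cp p) : Prop where
  ne_zero : v ≠ 0
  exists_smul : ∃ lam : ℂ, homTerm F (k + 1) v = lam • v
  nondegenerate : homTerm F (k + 1) v ≠ 0

/-- The point of `ℂ^p` with `j`-th coordinate `1` and other coordinates `u`, that is, the
representative `(1, u)` (in the coordinates reordered so that the `j`-th one is first) of
the point of projective space with affine coordinates `u`. -/
def affinePoint (j : Fin p) (u : {i : Fin p // i ≠ j} → ℂ) : Cp p :=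
  WithLp.toLp 2 fun i => if h : i = j then 1 else u ⟨i, h⟩

/-- The affine coordinates `v_i / v_j`, `i ≠ j`, of the point `[v]` with `v_j ≠ 0`. -/
def affineCoord (j : Fin p) (v : Cp p) : {i : Fin p // i ≠ j} → ℂ :=
  fun i => v i / v j

/-- The map `r(u) = q_{k+1}(1, u) - p_{k+1}(1, u) u`, where `P_{k+1} = (p_{k+1}, q_{k+1})`
is split into its `j`-th coordinate and the remaining ones. -/
def rMap (F : Cp p → Cp p) (k : ℕ) (j : Fin p) (u : {i : Fin p // i ≠ j} → ℂ) :
    {i : Fin p // i ≠ j} → ℂ :=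
  fun i => homTerm F (k + 1) (affinePoint j u) i
    - homTerm F (k + 1) (affinePoint j u) j * u i

/-- The matrix `A(v) = r'(u₀) / (k p_{k+1}(1, u₀))` associated to the non-degenerate
characteristic direction `[v] = [1 : u₀]`, in the chart `v_j ≠ 0`. -/
def directorMatrix (F : Cp p → Cp p) (k : ℕ) (j : Fin p) (v : Cp p) :
    Matrix {i : Fin p // i ≠ j} {i : Fin p // i ≠ j} ℂ :=
  ((k : ℂ) * homTerm F (k + 1) (affinePoint j (affineCoord j v)) j)⁻¹ •
    LinearMap.toMatrix'
      (fderiv ℂ (rMap F k j) (affineCoord j v) :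
        ({i : Fin p // i ≠ j} → ℂ) →ₗ[ℂ] ({i : Fin p // i ≠ j} → ℂ))

/-- The directors of `[v]`: the eigenvalues of `A(v)`, computed in the chart `v_j ≠ 0`. -/
def directors (F : Cp p → Cp p) (k : ℕ) (j : Fin p) (v : Cp p) : Set ℂ :=
  {a : ℂ | Module.End.HasEigenvalue (Matrix.toLin' (directorMatrix F k j v)) a}

/-- `[v]` is attracting: all its directors have strictly positive real part. The similarity
class of `A(v)` does not depend on the chart, so any one chart around `[v]` may be used. -/
def IsAttracting (F : Cp p → Cp p) (k : ℕ) (v : Cp p) : Prop :=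
  ∃ j : Fin p, v j ≠ 0 ∧ ∀ a ∈ directors F k j v, 0 < a.re

/-- The quotient topology of the complex projective space. -/
instance projTopology : TopologicalSpace (ℙ ℂ (Cp p)) :=
  TopologicalSpace.coinduced
    (fun w : {w : Cp p // w ≠ 0} => Projectivization.mk ℂ w.1 w.2) inferInstance

/-- The orbit of `z` is a characteristic trajectory tangent to `d`: `X_n = F^n(z)` is
nonzero for all `n`, `X_n → 0`, and `[X_n] → d` in projective space. -/
def IsCharTrajectory (F : Cp p → Cp p) (d : ℙ ℂ (Cp p)) (z : Cp p) : Prop :=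
  Tendsto (fun n : ℕ => F^[n] z) atTop (𝓝 0) ∧
  ∃ h : ∀ n : ℕ, F^[n] z ≠ 0,
    Tendsto (fun n : ℕ => Projectivization.mk ℂ (F^[n] z) (h n)) atTop (𝓝 d)

/-- A parabolic invariant domain attracted to the origin along `d`: a nonempty connected
open set with `0` on its boundary, mapped into itself by `F`, each of whose points is
attracted by the origin along a trajectory tangent to `d`. -/
structure IsParabolicDomain (F : Cp p → Cp p) (d : ℙ ℂ (Cp p)) (D : Set (Cp p)) : Prop where
  isOpen : IsOpen D
  isConnected : IsConnected D
  zero_mem_frontier : (0 : Cp p) ∈ frontier D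
  invariant : Set.MapsTo F D D
  trajectory : ∀ z ∈ D, IsCharTrajectory F d z

end ParabolicGerm

end

/-! No blow-up is needed: the proof rescales along real time. Write `F^[n] z = (t + n)^(-1/k) y_n`
and `P = P_{k+1}`. Uniformly for `y_n` near a fixed point, the expansion of `F` gives `y_{n+1} = y_n
+ (P(y_n) + y_n/k)/(t + n) + o(1/(t + n))`. This is an Euler scheme for the autonomous field `P(y) +
y/k`, with steps whose sum diverges. The nonzero equilibria of this field on `ℂ v` are the `k`
points `w = ζ v` with `ζ^k = -1/(kλ)`.

At `w` the linearisation has eigenvalue `-1` on `v`, by Euler's identity, and any eigenvector off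
that line has as eigenvalue minus a director (`re_neg_of_eigenvalue`). Hence an attracting `[v]`
makes every such `w` a stable equilibrium. In an adapted norm
(`exists_seminorm_contracting_of_eigenvalues_re_neg`) one step contracts towards `w` by `1 -
c/(2t)`, up to `o(1/t)` (`exists_rescaled_contraction`). So a small ball about `w` is preserved for
large `t`; undoing the scaling and taking the union over `t > T` gives an invariant sector, and a
discrete Gronwall argument gives `y_n → w` (`exists_invariant_sector`).

The asymptotics, the tangency to `[v]` and the disjointness of the sectors all follow from the
single limit `n^(1/k) F^[n] z → ζ v`. -/

noncomputable section

namespace ParabolicGerm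

/-! ### Norms adapted to a contracting or stable linear operator. -/

section AdaptedNorm

variable {E : Type*} [NormedAddCommGroup E] [NormedSpace ℂ E]

/-- A power of an operator of spectral radius less than one is dominated by the corresponding
power of a number less than one. -/
theorem exists_norm_pow_le_of_spectralRadius_lt_one [CompleteSpace E]
    (T : E →L[ℂ] E) (hT : spectralRadius ℂ T < 1) :
    ∃ ρ : ℝ, 0 < ρ ∧ ρ < 1 ∧ ∃ m : ℕ, 0 < m ∧ ‖T ^ m‖ ≤ ρ ^ m := by
  obtain ⟨ρ, hρ0, hρ1⟩ := ENNReal.lt_iff_exists_nnreal_btwn.1 hT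
  have hρ1' : (ρ : ℝ) < 1 := by exact_mod_cast hρ1
  have hpos : 0 < (ρ : ℝ) := by
    have : (0 : ENNReal) < ρ := lt_of_le_of_lt bot_le hρ0
    exact_mod_cast this
  have h := spectrum.pow_norm_pow_one_div_tendsto_nhds_spectralRadius T
  obtain ⟨m, hm, hm0⟩ := ((h.eventually (gt_mem_nhds hρ0)).and (eventually_gt_atTop 0)).exists
  refine ⟨ρ, hpos, hρ1', m, hm0, ?_⟩
  have h1 : ‖T ^ m‖ ^ (1 / (m : ℝ)) ≤ ρ := by
    rw [← ENNReal.ofReal_coe_nnreal] at hm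
    exact ((ENNReal.ofReal_lt_ofReal_iff hpos).1 hm).le
  have h2 : (0 : ℝ) < m := by exact_mod_cast hm0
  calc ‖T ^ m‖ = (‖T ^ m‖ ^ (1 / (m : ℝ))) ^ m := by
        rw [← Real.rpow_natCast, ← Real.rpow_mul (norm_nonneg _), one_div_mul_cancel h2.ne',
          Real.rpow_one]
    _ ≤ ρ ^ m := pow_le_pow_left₀ (by positivity) h1 m

/-- An operator of spectral radius less than one is a contraction for an equivalent norm. -/
theorem exists_seminorm_contracting_of_spectralRadius_lt_one [CompleteSpace E]
    (T : E →L[ℂ] E) (hT : spectralRadius ℂ T < 1) :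
    ∃ (q : Seminorm ℂ E) (K ρ : ℝ), ρ < 1 ∧ (∀ x, ‖x‖ ≤ q x) ∧ (∀ x, q x ≤ K * ‖x‖) ∧
      ∀ x, q (T x) ≤ ρ * q x := by
  obtain ⟨ρ, hρ0, hρ1, m, hm, hTm⟩ := exists_norm_pow_le_of_spectralRadius_lt_one T hT
  -- In the sum of these terms over `j < m`, applying `T` shifts the index by one at the cost of a
  -- factor `ρ`; the new last term is at most the lost first one because `‖T ^ m‖ ≤ ρ ^ m`.
  let g : ℕ → E → ℝ := fun j x => ρ⁻¹ ^ j * ‖(T ^ j) x‖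
  have hg : ∀ j x, 0 ≤ g j x := fun j x => by positivity
  let q : Seminorm ℂ E := Seminorm.of (fun x => ∑ j ∈ Finset.range m, g j x)
    (fun x y => by
      rw [← Finset.sum_add_distrib]
      refine Finset.sum_le_sum fun j _ => ?_
      simp only [g, ← mul_add, map_add]
      gcongr
      exact norm_add_le _ _)
    (fun a x => by
      rw [Finset.mul_sum]
      refine Finset.sum_congr rfl fun j _ => ?_
      simp only [g, map_smul, norm_smul]
      ring)
  have hq : ∀ x, q x = ∑ j ∈ Finset.range m, g j x := fun x => rfl
  refine ⟨q, ∑ j ∈ Finset.range m, ρ⁻¹ ^ j * ‖T ^ j‖, ρ, hρ1, fun x => ?_, fun x => ?_,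
    fun x => ?_⟩
  · have := Finset.single_le_sum (f := fun j => g j x) (fun j _ => hg j x)
      (Finset.mem_range.2 hm)
    simpa [hq, g] using this
  · rw [hq, Finset.sum_mul]
    refine Finset.sum_le_sum fun j _ => ?_
    simp only [g, mul_assoc]
    gcongr
    exact (T ^ j).le_opNorm x
  · have h1 : ∀ j, g j (T x) = ρ * g (j + 1) x := fun j => by
      simp only [g, pow_succ]
      rw [mul_apply_eq_comp]
      field_simp
    have h2 : ∑ j ∈ Finset.range m, g (j + 1) x + g 0 x
        = ∑ j ∈ Finset.range m, g j x + g m x := by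
      rw [← Finset.sum_range_succ' (fun j => g j x), Finset.sum_range_succ]
    have h3 : g m x ≤ g 0 x := by
      have : ‖(T ^ m) x‖ ≤ ρ ^ m * ‖x‖ := (T ^ m).le_of_opNorm_le hTm x
      simp only [g, pow_zero, one_mul, one_apply_eq_self]
      calc ρ⁻¹ ^ m * ‖(T ^ m) x‖ ≤ ρ⁻¹ ^ m * (ρ ^ m * ‖x‖) := by gcongr
        _ = ‖x‖ := by rw [← mul_assoc, ← mul_pow, inv_mul_cancel₀ hρ0.ne', one_pow, one_mul]
    rw [hq, hq, Finset.sum_congr rfl fun j _ => h1 j, ← Finset.mul_sum]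
    exact mul_le_mul_of_nonneg_left (by linarith) hρ0.le

theorem exists_eigenvector_of_mem_spectrum [FiniteDimensional ℂ E] {M : E →L[ℂ] E} {μ : ℂ}
    (h : μ ∈ spectrum ℂ M) : ∃ x, x ≠ 0 ∧ M x = μ • x := by
  have h1 : μ ∈ spectrum ℂ (M : E →ₗ[ℂ] E) := by
    rw [← AlgEquiv.spectrum_eq (Module.End.toContinuousLinearMap (𝕜 := ℂ) E) (M : E →ₗ[ℂ] E)]
    exact h
  obtain ⟨x, hx⟩ := (Module.End.hasEigenvalue_iff_mem_spectrum.2 h1).exists_hasEigenvector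
  exact ⟨x, hx.2, hx.apply_eq_smul⟩

/-- If all eigenvalues of `M` have negative real part, then, for an equivalent norm, `1 + s M`
contracts by the factor `1 - c s` for all small positive `s`. -/
theorem exists_seminorm_contracting_of_eigenvalues_re_neg [FiniteDimensional ℂ E] [Nontrivial E]
    (M : E →L[ℂ] E) (hM : ∀ (μ : ℂ) (x : E), x ≠ 0 → M x = μ • x → μ.re < 0) :
    ∃ (q : Seminorm ℂ E) (K c h : ℝ), 0 < c ∧ 0 < h ∧ (∀ x, ‖x‖ ≤ q x) ∧
      (∀ x, q x ≤ K * ‖x‖) ∧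
      ∀ s : ℝ, 0 ≤ s → s ≤ h → ∀ x, q (x + (s : ℂ) • M x) ≤ (1 - c * s) * q x := by
  have : CompleteSpace E := FiniteDimensional.complete ℂ E
  obtain ⟨μ₀, hμ₀, hmax⟩ := (spectrum.isCompact (𝕜 := ℂ) M).exists_isMaxOn
    (spectrum.nonempty M) Complex.continuous_re.continuousOn
  have ha : μ₀.re < 0 := by
    obtain ⟨x, hx, hMx⟩ := exists_eigenvector_of_mem_spectrum hμ₀
    exact hM μ₀ x hx hMx
  -- Chosen so that `h ‖M‖² ≤ -Re μ₀`; then `|1 + hν|² = 1 + 2h Re ν + h²|ν|² < 1` for every `ν` in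
  -- the spectrum of `M`.
  set h : ℝ := -μ₀.re / (‖M‖ ^ 2 + 1) with hh
  have hpos : 0 < h := div_pos (by linarith) (by positivity)
  have hhM : h * (‖M‖ ^ 2 + 1) = -μ₀.re := div_mul_cancel₀ _ (by positivity)
  set T : E →L[ℂ] E := 1 + (h : ℂ) • M with hT
  have hrad : spectralRadius ℂ T < 1 := by
    refine spectrum.spectralRadius_lt_of_forall_lt T (r := 1) fun μ hμ => ?_
    obtain ⟨x, hx, hTx⟩ := exists_eigenvector_of_mem_spectrum hμ
    have hh0 : (h : ℂ) ≠ 0 := by exact_mod_cast hpos.ne'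
    set ν : ℂ := (μ - 1) / h with hν
    have hμν : μ = 1 + h * ν := by rw [hν]; field_simp; ring
    have hMx : M x = ν • x := by
      have h1 : x + (h : ℂ) • M x = μ • x := by simpa [hT] using hTx
      have h2 : (h : ℂ) • M x = (h : ℂ) • (ν • x) := by
        rw [smul_smul]
        have : (h : ℂ) * ν = μ - 1 := by rw [hμν]; ring
        rw [this, sub_smul, one_smul, ← h1]; abel
      exact smul_right_injective E hh0 h2
    have hmem : ν ∈ spectrum ℂ M := by
      rw [← AlgEquiv.spectrum_eq (Module.End.toContinuousLinearMap (𝕜 := ℂ) E).symm M]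
      refine (Module.End.hasEigenvalue_of_hasEigenvector (x := x) ?_).mem_spectrum
      exact ⟨Module.End.mem_eigenspace_iff.2 hMx, hx⟩
    have hre : ν.re ≤ μ₀.re := hmax hmem
    have hnorm : ‖ν‖ ≤ ‖M‖ := spectrum.norm_le_norm_of_mem hmem
    have hsq : ‖μ‖ ^ 2 < 1 := by
      have e1 : ‖μ‖ ^ 2 = 1 + 2 * h * ν.re + h ^ 2 * ‖ν‖ ^ 2 := by
        rw [hμν, ← Complex.normSq_eq_norm_sq, ← Complex.normSq_eq_norm_sq,
          Complex.normSq_apply, Complex.normSq_apply]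
        simp
        ring
      have e2 : ‖ν‖ ^ 2 ≤ ‖M‖ ^ 2 := pow_le_pow_left₀ (norm_nonneg _) hnorm 2
      have e3 : h * ‖ν‖ ^ 2 ≤ -μ₀.re := by nlinarith
      have e4 : h * (2 * ν.re + h * ‖ν‖ ^ 2) < 0 :=
        mul_neg_of_pos_of_neg hpos (by linarith)
      rw [e1]; linarith
    have : ‖μ‖ < 1 := by
      by_contra hcon
      push Not at hcon
      nlinarith
    exact_mod_cast this
  obtain ⟨q, K, ρ, hρ, hq1, hq2, hq3⟩ :=
    exists_seminorm_contracting_of_spectralRadius_lt_one T hrad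
  refine ⟨q, K, (1 - ρ) / h, h, div_pos (by linarith) hpos, hpos, hq1, hq2,
    fun s hs hsh x => ?_⟩
  have hh0 : (h : ℂ) ≠ 0 := by exact_mod_cast hpos.ne'
  -- `1 + sM` is a convex combination of `1` and `T = 1 + hM`, so the contraction at `s = h` yields
  -- the linear rate `c = (1 - ρ)/h` for all smaller `s`.
  have hsplit : x + (s : ℂ) • M x = ((1 - s / h : ℝ) : ℂ) • x + ((s / h : ℝ) : ℂ) • T x := by
    have : T x = x + (h : ℂ) • M x := by simp [hT]
    rw [this]
    push_cast
    rw [smul_add, smul_smul, div_mul_cancel₀ _ hh0, sub_smul, one_smul]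
    abel
  have hs1 : 0 ≤ s / h := by positivity
  have hs2 : 0 ≤ 1 - s / h := by
    have : s / h ≤ 1 := (div_le_one hpos).2 hsh
    linarith
  calc q (x + (s : ℂ) • M x)
      ≤ (1 - s / h) * q x + s / h * q (T x) := by
        rw [hsplit]
        refine (map_add_le_add q _ _).trans (le_of_eq ?_)
        rw [map_smul_eq_mul, map_smul_eq_mul, Complex.norm_real, Complex.norm_real,
          Real.norm_of_nonneg hs1, Real.norm_of_nonneg hs2]
    _ ≤ (1 - s / h) * q x + s / h * (ρ * q x) := by gcongr; exact hq3 x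
    _ = (1 - (1 - ρ) / h * s) * q x := by ring

end AdaptedNorm

/-! ### Homogeneity and the Taylor expansion of the germ. -/

section HomogeneousTerms

variable {p : ℕ} (F : Cp p → Cp p) (m : ℕ)

theorem homTerm_smul (c : ℂ) (z : Cp p) : homTerm F m (c • z) = c ^ m • homTerm F m z := by
  have h := (iteratedFDeriv ℂ m F 0).map_smul_univ (fun _ => c) (fun _ => z)
  rw [Fin.prod_const] at h
  rw [homTerm, homTerm, h, smul_comm]

theorem differentiable_homTerm : Differentiable ℂ (homTerm F m) := by
  intro z
  have h := HasFDerivAt.multilinear_comp (iteratedFDeriv ℂ m F 0)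
    (g := fun _ => fun z : Cp p => z) (x := z) fun _ => hasFDerivAt_id z
  exact h.differentiableAt.const_smul ((m.factorial : ℂ)⁻¹)

/-- Differentiate `y ↦ P(c y) = c^(m+1) P(y)` in two ways and cancel one factor `c`. -/
theorem fderiv_homTerm_smul {c : ℂ} (hc : c ≠ 0) (z x : Cp p) :
    fderiv ℂ (homTerm F (m + 1)) (c • z) x = c ^ m • fderiv ℂ (homTerm F (m + 1)) z x := by
  have h1 : HasFDerivAt (fun y => homTerm F (m + 1) (c • y))
      ((fderiv ℂ (homTerm F (m + 1)) (c • z)).comp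
        (c • ContinuousLinearMap.id ℂ (Cp p))) z :=
    HasFDerivAt.comp (g := homTerm F (m + 1)) z
      (differentiable_homTerm F (m + 1) (c • z)).hasFDerivAt
      ((hasFDerivAt_id z).const_smul c)
  have h2 : HasFDerivAt (fun y => homTerm F (m + 1) (c • y))
      (c ^ (m + 1) • fderiv ℂ (homTerm F (m + 1)) z) z := by
    simp_rw [homTerm_smul]
    exact (differentiable_homTerm F (m + 1) z).hasFDerivAt.const_smul (c ^ (m + 1))
  have h3 := congrArg (fun L : Cp p →L[ℂ] Cp p => L x) (h1.unique h2)
  simp only [ContinuousLinearMap.comp_apply, smul_apply,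
    ContinuousLinearMap.id_apply, map_smul, pow_succ'] at h3
  rw [mul_smul] at h3
  exact smul_right_injective _ hc h3

/-- Euler's identity. -/
theorem fderiv_homTerm_self (z : Cp p) :
    fderiv ℂ (homTerm F m) z z = (m : ℂ) • homTerm F m z := by
  have h1 : HasDerivAt (fun c : ℂ => homTerm F m (c • z)) (fderiv ℂ (homTerm F m) z z) 1 := by
    have h0 : HasDerivAt (fun c : ℂ => c • z) ((1 : ℂ) • z) 1 := (hasDerivAt_id 1).smul_const z
    have h := (differentiable_homTerm F m ((1 : ℂ) • z)).hasFDerivAt.comp_hasDerivAt (1 : ℂ) h0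
    simpa only [one_smul] using! h
  have h2 : HasDerivAt (fun c : ℂ => homTerm F m (c • z)) ((m : ℂ) • homTerm F m z) 1 := by
    simp_rw [homTerm_smul]
    simpa using (hasDerivAt_pow m (1 : ℂ)).smul_const (homTerm F m z)
  exact h1.unique h2

variable {F}

/-- The expansion `F(z) = z + P_{k+1}(z) + O(‖z‖^{k+2})`. -/
theorem isBigO_sub_homTerm {k : ℕ} (hk : 1 ≤ k) (hF : IsTangentToIdentity F)
    (hord : HasOrder F (k + 1)) :
    (fun z => F z - z - homTerm F (k + 1) z) =O[𝓝 0] fun z => ‖z‖ ^ (k + 2) := by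
  obtain ⟨φ, hφ⟩ := hF.analyticAt
  have h := hφ.isBigO_sub_partialSum_pow (k + 2)
  refine h.congr_left fun z => ?_
  have h0 : homTerm F 0 z = 0 := by
    simp [homTerm, hF.map_zero]
  have h1 : homTerm F 1 z = z := by
    simp [homTerm, iteratedFDeriv_one_apply, hF.fderiv_eq]
  -- Minimality of the order kills the terms of degrees `2, …, k`.
  have hmid : ∀ m ∈ Finset.range (k - 1), homTerm F (m + 1 + 1) z = 0 := fun m hm => by
    rw [Finset.mem_range] at hm
    by_contra hne
    have : k + 1 ≤ m + 1 + 1 := hord.2 ⟨by omega, fun h0 => hne (by rw [h0]; rfl)⟩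
    omega
  have hsum : φ.partialSum (k + 2) z = z + homTerm F (k + 1) z := by
    have e : φ.partialSum (k + 2) z = ∑ m ∈ Finset.range (k + 2), homTerm F m z := by
      rw [FormalMultilinearSeries.partialSum]
      exact Finset.sum_congr rfl fun m _ => (homTerm_eq hφ m z).symm
    obtain ⟨l, rfl⟩ : ∃ l, k = l + 1 := ⟨k - 1, by omega⟩
    rw [e, Finset.sum_range_succ, Finset.sum_range_succ', Finset.sum_range_succ',
      Finset.sum_eq_zero (s := Finset.range l) hmid, h0, zero_add, add_zero, zero_add, h1]
  rw [hsum, zero_add, sub_sub]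

end HomogeneousTerms

/-! ### Directors as eigenvalues of the differential of `P_{k+1}` modulo the line of `v`. -/

section Directors

variable {p : ℕ} {F : Cp p → Cp p} {k : ℕ}

theorem affinePoint_affineCoord {j : Fin p} {v : Cp p} (hj : v j ≠ 0) :
    affinePoint j (affineCoord j v) = (v j)⁻¹ • v := by
  ext i
  by_cases h : i = j
  · subst h; simp [affinePoint, hj]
  · simp [affinePoint, affineCoord, h, div_eq_inv_mul]

/-- The differential of `affinePoint j`. -/
def affinePointDeriv (j : Fin p) : ({i : Fin p // i ≠ j} → ℂ) →L[ℂ] Cp p :=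
  LinearMap.toContinuousLinearMap
    { toFun := fun u => WithLp.toLp 2 fun i => if h : i = j then 0 else u ⟨i, h⟩
      map_add' := fun u u' => by ext i; by_cases h : i = j <;> simp [h]
      map_smul' := fun c u => by ext i; by_cases h : i = j <;> simp [h] }

theorem affinePointDeriv_apply (j : Fin p) (u : {i : Fin p // i ≠ j} → ℂ) (i : Fin p) :
    affinePointDeriv j u i = if h : i = j then 0 else u ⟨i, h⟩ := rfl

theorem hasFDerivAt_affinePoint (j : Fin p) (u : {i : Fin p // i ≠ j} → ℂ) :
    HasFDerivAt (affinePoint j) (affinePointDeriv j) u := by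
  have : affinePoint j = fun u => affinePoint j 0 + affinePointDeriv j u := by
    funext u
    ext i
    by_cases h : i = j <;> simp [affinePoint, affinePointDeriv_apply, h]
  rw [this]
  exact (affinePointDeriv j).hasFDerivAt.const_add _

theorem fderiv_rMap_apply (j : Fin p) (u h : {i : Fin p // i ≠ j} → ℂ)
    (i : {i : Fin p // i ≠ j}) :
    fderiv ℂ (rMap F k j) u h i =
      fderiv ℂ (homTerm F (k + 1)) (affinePoint j u) (affinePointDeriv j h) i
        - (homTerm F (k + 1) (affinePoint j u) j * h i
          + fderiv ℂ (homTerm F (k + 1)) (affinePoint j u) (affinePointDeriv j h) j * u i) := by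
  have hP : HasFDerivAt (fun u => homTerm F (k + 1) (affinePoint j u))
      ((fderiv ℂ (homTerm F (k + 1)) (affinePoint j u)).comp (affinePointDeriv j)) u :=
    (differentiable_homTerm F (k + 1) (affinePoint j u)).hasFDerivAt.comp u
      (hasFDerivAt_affinePoint j u)
  have hc : ∀ l : Fin p, HasFDerivAt (fun u => homTerm F (k + 1) (affinePoint j u) l)
      ((EuclideanSpace.proj (𝕜 := ℂ) l).comp
        ((fderiv ℂ (homTerm F (k + 1)) (affinePoint j u)).comp (affinePointDeriv j))) u :=
    fun l => (EuclideanSpace.proj (𝕜 := ℂ) l).hasFDerivAt.comp u hP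
  have hr : HasFDerivAt (rMap F k j) (ContinuousLinearMap.pi fun l : {i : Fin p // i ≠ j} =>
      ((EuclideanSpace.proj (𝕜 := ℂ) l.1).comp
        ((fderiv ℂ (homTerm F (k + 1)) (affinePoint j u)).comp (affinePointDeriv j)))
      - (homTerm F (k + 1) (affinePoint j u) j • ContinuousLinearMap.proj l
        + u l • (EuclideanSpace.proj (𝕜 := ℂ) j).comp
        ((fderiv ℂ (homTerm F (k + 1)) (affinePoint j u)).comp (affinePointDeriv j)))) u :=
    hasFDerivAt_pi.2 fun l =>
      (hc l.1).sub ((hc j).mul (hasFDerivAt_apply (𝕜 := ℂ) l u))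
  rw [hr.fderiv]
  simp [mul_comm]

/-- An eigenvector of `DP_{k+1}(v)` which is not proportional to `v` gives a director. -/
theorem mem_directors_of_eigenvector (hk : 1 ≤ k) {j : Fin p} {v : Cp p} (hj : v j ≠ 0)
    {lam : ℂ} (hlam : lam ≠ 0) (hP : homTerm F (k + 1) v = lam • v) {x : Cp p} {μ : ℂ}
    (hx : fderiv ℂ (homTerm F (k + 1)) v x = μ • x) (hxv : ∀ c : ℂ, x ≠ c • v) :
    (μ - lam) / (k * lam) ∈ directors F k j v := by
  have hk0 : (k : ℂ) ≠ 0 := by exact_mod_cast (by omega : k ≠ 0)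
  -- The projection of `x` along `v` onto the hyperplane of vanishing `j`-th coordinate: up to the
  -- scalar `v j`, the tangent vector that `x` induces at `[v]` in the chart. It vanishes only if
  -- `x` lies on `ℂ v`.
  set h : {i : Fin p // i ≠ j} → ℂ := fun i => x i - v i / v j * x j with hh
  have hhx : affinePointDeriv j h = x - (x j / v j) • v := by
    ext i
    by_cases hi : i = j
    · subst hi; simp [affinePointDeriv_apply, hj]
    · simp [affinePointDeriv_apply, hi, hh]; ring
  have hne : h ≠ 0 := fun h0 => hxv (x j / v j) (by
    rw [h0, map_zero] at hhx; exact (sub_eq_zero.1 hhx.symm))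
  have hval : homTerm F (k + 1) (affinePoint j (affineCoord j v)) j = ((v j)⁻¹) ^ k * lam := by
    rw [affinePoint_affineCoord hj, homTerm_smul, hP]
    simp [pow_succ]
    field_simp
  have hder : fderiv ℂ (homTerm F (k + 1)) (affinePoint j (affineCoord j v))
      (affinePointDeriv j h) = ((v j)⁻¹) ^ k • (μ • x - (x j / v j * ((k + 1) * lam)) • v) := by
    rw [affinePoint_affineCoord hj, fderiv_homTerm_smul F k (inv_ne_zero hj), hhx, map_sub,
      map_smul, hx, fderiv_homTerm_self, hP, smul_smul, smul_smul]
    push_cast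
    rw [mul_assoc]
  refine Module.End.hasEigenvalue_of_hasEigenvector (x := h)
    ⟨Module.End.mem_eigenspace_iff.2 ?_, hne⟩
  have hvk : (v j) ^ k ≠ 0 := pow_ne_zero _ hj
  funext i
  rw [directorMatrix, hval, map_smul, LinearMap.smul_apply, Matrix.toLin'_toMatrix',
    ContinuousLinearMap.coe_coe, Pi.smul_apply, fderiv_rMap_apply, hder, hval]
  simp only [hh, affineCoord, PiLp.smul_apply, PiLp.sub_apply, smul_eq_mul, Pi.smul_apply, inv_pow]
  field_simp
  ring

end Directors

/-! ### The rescaled dynamics near an equilibrium and the invariant sector. -/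

section Dynamics

/-- A discrete Gronwall argument: the recursion `e_{n+1} ≤ (1 - c / t_n) e_n + o(1 / t_n)` along
an arithmetic progression `t_n = t + n` forces `e_n → 0`. -/
theorem tendsto_zero_of_recursion {e : ℕ → ℝ} (he : ∀ n, 0 ≤ e n) {t c : ℝ} (ht : 1 ≤ t)
    (hc : 0 < c) (hc1 : c ≤ 1)
    (h : ∀ δ > 0, ∀ᶠ n : ℕ in atTop, e (n + 1) ≤ (1 - c / (t + n)) * e n + δ / (t + n)) :
    Tendsto e atTop (𝓝 0) := by
  have htn : ∀ n : ℕ, 1 ≤ t + n := fun n => by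
    have : (0 : ℝ) ≤ n := n.cast_nonneg
    linarith
  rw [Metric.tendsto_atTop]
  intro η hη
  obtain ⟨N, hN⟩ := eventually_atTop.1 (h (c * (η / 2)) (by positivity))
  -- With forcing `δ = c η / 2` the affine recursion fixes the level `η / 2`, so the excess above it
  -- obeys the homogeneous recursion.
  let g : ℕ → ℝ := fun n => max (e n - η / 2) 0
  have hg0 : ∀ n, 0 ≤ g n := fun n => le_max_right _ _
  have hstep : ∀ n ≥ N, g (n + 1) ≤ (1 - c / (t + n)) * g n := fun n hn => by
    have h1 : 0 ≤ 1 - c / (t + n) := by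
      have : c / (t + n) ≤ 1 := (div_le_one (by linarith [htn n])).2 (by linarith [htn n])
      linarith
    refine max_le ?_ (mul_nonneg h1 (hg0 n))
    have h2 : e n - η / 2 ≤ g n := le_max_left _ _
    have h3 := hN n hn
    have h4 : c * (η / 2) / (t + n) = c / (t + n) * (η / 2) := by ring
    nlinarith [mul_le_mul_of_nonneg_left h2 h1]
  -- The excess decays at least like `(t + n)^(-c)`: by Bernoulli, which needs `c ≤ 1`, `(1 - c/t)(1
  -- + 1/t)^c ≤ 1 - (c/t)²`.
  have hmono : ∀ n ≥ N, g n * (t + n) ^ c ≤ g N * (t + N) ^ c := fun n hn => by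
    induction n, hn using Nat.le_induction with
    | base => exact le_rfl
    | succ n hn ih =>
      refine le_trans ?_ ih
      have hpos : 0 < t + n := by linarith [htn n]
      have h1 : (t + (n + 1 : ℕ)) ^ c = (t + n) ^ c * (1 + 1 / (t + n)) ^ c := by
        rw [← Real.mul_rpow hpos.le (by positivity)]
        congr 1
        push_cast
        field_simp
        ring
      have h2 : (1 + 1 / (t + n)) ^ c ≤ 1 + c * (1 / (t + n)) :=
        rpow_one_add_le_one_add_mul_self (by linarith [one_div_pos.2 hpos]) hc.le hc1
      have h3 : (1 - c / (t + n)) * (1 + 1 / (t + n)) ^ c ≤ 1 := by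
        have h4 : 0 ≤ 1 - c / (t + n) := by
          have : c / (t + n) ≤ 1 := (div_le_one hpos).2 (by linarith [htn n])
          linarith
        calc _ ≤ (1 - c / (t + n)) * (1 + c * (1 / (t + n))) := by gcongr
          _ = 1 - (c / (t + n)) ^ 2 := by ring
          _ ≤ 1 := by linarith [sq_nonneg (c / (t + n))]
      calc g (n + 1) * (t + (n + 1 : ℕ)) ^ c
          ≤ ((1 - c / (t + n)) * g n) * ((t + n) ^ c * (1 + 1 / (t + n)) ^ c) := by
            rw [h1]; gcongr; exact hstep n hn
        _ = (g n * (t + n) ^ c) * ((1 - c / (t + n)) * (1 + 1 / (t + n)) ^ c) := by ring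
        _ ≤ (g n * (t + n) ^ c) * 1 := by
            gcongr
        _ = g n * (t + n) ^ c := mul_one _
  have hlim : Tendsto (fun n : ℕ => (t + n : ℝ) ^ c) atTop atTop :=
    (tendsto_rpow_atTop hc).comp (tendsto_atTop_add_const_left _ _ tendsto_natCast_atTop_atTop)
  have hev := (tendsto_atTop.1 hlim (g N * (t + N) ^ c / (η / 4)))
  obtain ⟨N', hN'⟩ := eventually_atTop.1 hev
  refine ⟨max N N', fun n hn => ?_⟩
  have h1 := hmono n (le_of_max_le_left hn)
  have h2 := hN' n (le_of_max_le_right hn)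
  rw [div_le_iff₀ (by positivity)] at h2
  have h3 : 0 < (t + n : ℝ) ^ c := Real.rpow_pos_of_pos (by linarith [htn n]) _
  have h4 : g n ≤ η / 4 := by
    by_contra hcon
    push Not at hcon
    nlinarith [mul_lt_mul_of_pos_right hcon h3]
  have h5 : e n - η / 2 ≤ g n := le_max_left _ _
  rw [Real.dist_eq, sub_zero, abs_of_nonneg (he n)]
  linarith

/-- This is the derivative of `x ^ α` at `1`. With `α = 1/k` it produces the term `y / k` of the
rescaled field. -/
theorem eventually_abs_one_add_inv_rpow_sub_le (α : ℝ) {δ : ℝ} (hδ : 0 < δ) :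
    ∀ᶠ t : ℝ in atTop, |(1 + 1 / t) ^ α - 1 - α / t| ≤ δ / t := by
  have h1 : HasDerivAt (fun x : ℝ => x ^ α) α 1 := by
    simpa using Real.hasDerivAt_rpow_const (x := 1) (p := α) (Or.inl one_ne_zero)
  have h2 := (hasDerivAt_iff_isLittleO_nhds_zero.1 h1).def hδ
  have h3 : Tendsto (fun t : ℝ => 1 / t) atTop (𝓝 0) := by
    simpa using tendsto_inv_atTop_zero (𝕜 := ℝ)
  filter_upwards [h3.eventually h2, eventually_gt_atTop 0] with t ht ht0
  rw [Real.norm_eq_abs, Real.norm_of_nonneg (by positivity), Real.one_rpow] at ht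
  calc _ = |(1 + 1 / t) ^ α - 1 - (1 / t) • α| := by rw [smul_eq_mul, one_div_mul_eq_div]
    _ ≤ δ * (1 / t) := ht
    _ = δ / t := by ring

variable {E : Type*} [NormedAddCommGroup E] [NormedSpace ℂ E]

/-- The rescaled map `y ↦ (t + 1)^{1/k} F(t^{-1/k} y)` contracts towards the equilibrium `w` of
the vector field `P(y) + y / k`, up to an error which is `o(1 / t)`. -/
theorem exists_rescaled_contraction {k : ℕ} (hk : 1 ≤ k) {F P : E → E} {L : E →L[ℂ] E} {w : E}
    (hF : (fun z => F z - z - P z) =O[𝓝 0] fun z => ‖z‖ ^ (k + 2))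
    (hP : ∀ (c : ℂ) z, P (c • z) = c ^ (k + 1) • P z)
    (hPw : P w = -((k : ℂ)⁻¹ • w)) (hL : HasFDerivAt P L w)
    {q : Seminorm ℂ E} {K c h : ℝ} (hc : 0 < c) (hh : 0 < h)
    (hq1 : ∀ x, ‖x‖ ≤ q x) (hq2 : ∀ x, q x ≤ K * ‖x‖)
    (hq : ∀ s : ℝ, 0 ≤ s → s ≤ h → ∀ x,
      q (x + (s : ℂ) • (L x + (k : ℂ)⁻¹ • x)) ≤ (1 - c * s) * q x) :
    ∃ ε > 0, ∀ δ > 0, ∀ᶠ t : ℝ in atTop, ∀ y, q (y - w) ≤ ε →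
      q ((((t + 1) ^ (1 / (k : ℝ)) : ℝ) : ℂ) • F (((t ^ (-(1 / (k : ℝ))) : ℝ) : ℂ) • y) - w)
        ≤ (1 - c / 2 / t) * q (y - w) + δ / t := by
  have hk0 : (k : ℝ) ≠ 0 := by exact_mod_cast (by omega : k ≠ 0)
  set α : ℝ := 1 / (k : ℝ) with hα
  have hα0 : 0 < α := by positivity
  have hα1 : α ≤ 1 := by
    rw [hα, div_le_one (by positivity)]; exact_mod_cast hk
  have hαc : ((α : ℝ) : ℂ) = (k : ℂ)⁻¹ := by rw [hα]; push_cast; rw [one_div]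
  -- replace `K` by a positive constant
  set K' : ℝ := max K 1 with hK'
  have hK'0 : 0 < K' := lt_of_lt_of_le one_pos (le_max_right _ _)
  have hq2' : ∀ x, q x ≤ K' * ‖x‖ := fun x =>
    (hq2 x).trans (mul_le_mul_of_nonneg_right (le_max_left _ _) (norm_nonneg x))
  -- The Taylor error of `P` at `w`, once converted to `q` at the cost of `K'`, then uses up exactly
  -- half of the contraction rate.
  set η : ℝ := c / (2 * K') with hη
  have hη0 : 0 < η := by positivity
  have hηK : K' * η = c / 2 := by rw [hη]; field_simp
  have hlin := (hasFDerivAt_iff_isLittleO.1 hL).def hη0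
  have hcont : ∀ᶠ y in 𝓝 w, ‖P y‖ < ‖P w‖ + 1 :=
    hL.continuousAt.norm.eventually (gt_mem_nhds (lt_add_one _))
  obtain ⟨ε, hε, hball⟩ := Metric.nhds_basis_closedBall.mem_iff.1 (hlin.and hcont)
  obtain ⟨C, hC0, hC⟩ := hF.exists_pos
  obtain ⟨r, hr, hCr⟩ := Metric.nhds_basis_closedBall.mem_iff.1 hC.bound
  set B : ℝ := ‖w‖ + ε with hB
  have hB0 : 0 < B := by positivity
  refine ⟨ε, hε, fun δ hδ => ?_⟩
  have hs0 : Tendsto (fun t : ℝ => t ^ (-α)) atTop (𝓝 0) := tendsto_rpow_neg_atTop hα0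
  have hinv : Tendsto (fun t : ℝ => t⁻¹) atTop (𝓝 0) := tendsto_inv_atTop_zero
  have hsmall : ∀ᶠ t : ℝ in atTop,
      t⁻¹ * (‖P w‖ + 1) + 2 * C * B ^ (k + 2) * t ^ (-α) < δ / K' / 2 := by
    have : Tendsto (fun t : ℝ => t⁻¹ * (‖P w‖ + 1) + 2 * C * B ^ (k + 2) * t ^ (-α)) atTop
        (𝓝 (0 * (‖P w‖ + 1) + 2 * C * B ^ (k + 2) * 0)) :=
      (hinv.mul_const _).add (hs0.const_mul _)
    refine this.eventually (gt_mem_nhds ?_)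
    rw [zero_mul, mul_zero, add_zero]
    positivity
  have hsr : ∀ᶠ t : ℝ in atTop, t ^ (-α) * B < r := by
    have : Tendsto (fun t : ℝ => t ^ (-α) * B) atTop (𝓝 (0 * B)) := hs0.mul_const _
    refine this.eventually (gt_mem_nhds ?_)
    rwa [zero_mul]
  filter_upwards [hsmall, hsr, eventually_abs_one_add_inv_rpow_sub_le α
    (show 0 < δ / K' / 2 / B by positivity), eventually_ge_atTop 1,
    eventually_ge_atTop (1 / h)] with t ht1 ht2 ht3 ht4 ht5 y hy
  have ht0 : 0 < t := by linarith
  set s : ℝ := t ^ (-α) with hs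
  set τ : ℝ := (t + 1) ^ α with hτ
  have hspos : 0 < s := Real.rpow_pos_of_pos ht0 _
  have hτpos : 0 < τ := Real.rpow_pos_of_pos (by linarith) _
  set l : ℝ := (1 + 1 / t) ^ α with hl
  -- This fixes the exponent `1/k`: the term of degree `k + 1` acquires the step size `1/t`.
  have hsk : s ^ k = t⁻¹ := by
    rw [hs, ← Real.rpow_natCast, ← Real.rpow_mul ht0.le, hα]
    rw [show -(1 / (k : ℝ)) * k = -1 by field_simp, Real.rpow_neg_one]
  have hτs : τ * s = l := by
    rw [hτ, hs, hl, Real.rpow_neg ht0.le, ← div_eq_mul_inv, ← Real.div_rpow (by linarith) ht0.le]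
    congr 1
    field_simp
  have hl1 : 1 ≤ l := Real.one_le_rpow (by linarith [one_div_pos.2 ht0]) hα0.le
  have hl2 : l ≤ 1 + α * (1 / t) :=
    rpow_one_add_le_one_add_mul_self (by linarith [one_div_pos.2 ht0]) hα0.le hα1
  have hl3 : l - 1 ≤ t⁻¹ := by
    have : α * (1 / t) ≤ 1 * (1 / t) := by gcongr
    rw [one_mul, one_div] at this
    rw [one_div] at hl2
    linarith
  have hl4 : l ≤ 2 := by
    have : t⁻¹ ≤ 1 := inv_le_one_of_one_le₀ ht4
    linarith
  have hyw : ‖y - w‖ ≤ ε := (hq1 _).trans hy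
  have hyB : ‖y‖ ≤ B := by
    have := norm_add_le w (y - w)
    rw [add_sub_cancel] at this
    linarith
  obtain ⟨hlin', hPy⟩ := hball (show y ∈ Metric.closedBall w ε by
    rwa [Metric.mem_closedBall, dist_eq_norm])
  have hsy : ‖(s : ℂ) • y‖ ≤ s * B := by
    rw [norm_smul, Complex.norm_real, Real.norm_of_nonneg hspos.le]
    gcongr
  have hR : ‖F ((s : ℂ) • y) - (s : ℂ) • y - P ((s : ℂ) • y)‖ ≤ C * (s * B) ^ (k + 2) := by
    have h1 := hCr (show (s : ℂ) • y ∈ Metric.closedBall 0 r by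
      rw [mem_closedBall_zero_iff]; linarith)
    refine (le_trans h1 ?_)
    rw [norm_pow, norm_norm]
    gcongr
  set R : E := F ((s : ℂ) • y) - (s : ℂ) • y - P ((s : ℂ) • y) with hRdef
  set Q : E := P y - P w - L (y - w) with hQ
  have hFy : F ((s : ℂ) • y) = R + (s : ℂ) • y + ((s : ℂ) ^ (k + 1)) • P y := by
    rw [hRdef, ← hP]; abel
  -- A linearised Euler step of size `1/t`, plus four errors: the Taylor remainder `Q` of `P`, the
  -- error in `(1 + 1/t)^α ≈ 1 + α/t`, a product of two terms of size `1/t`, and the remainder `R`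
  -- of `F`, which contributes `O(t^(-1-1/k))`.
  have hsplit : (τ : ℂ) • F ((s : ℂ) • y) - w
      = ((y - w) + ((t⁻¹ : ℝ) : ℂ) • (L (y - w) + (k : ℂ)⁻¹ • (y - w)))
        + (((t⁻¹ : ℝ) : ℂ) • Q + (((l - 1 - α / t : ℝ) : ℂ) • y
          + ((((l - 1) * t⁻¹ : ℝ) : ℂ) • P y + (τ : ℂ) • R))) := by
    have e1 : (τ : ℂ) * (s : ℂ) = (l : ℂ) := by exact_mod_cast hτs
    have e2 : (τ : ℂ) * (s : ℂ) ^ (k + 1) = (l : ℂ) * (t : ℂ)⁻¹ := by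
      rw [pow_succ', ← mul_assoc, e1]
      congr 1
      exact_mod_cast hsk
    have e3 : L (y - w) = P y + (k : ℂ)⁻¹ • w - Q := by
      rw [hQ, hPw]; abel
    rw [hFy, smul_add, smul_add, smul_smul, smul_smul, e1, e2, e3]
    push_cast
    rw [hαc]
    module
  have hnorm : ∀ (a : ℝ) (x : E), ‖(a : ℂ) • x‖ = |a| * ‖x‖ := fun a x => by
    rw [norm_smul, Complex.norm_real, Real.norm_eq_abs]
  have htinv : 0 < t⁻¹ := inv_pos.2 ht0
  have b0 : q ((y - w) + ((t⁻¹ : ℝ) : ℂ) • (L (y - w) + (k : ℂ)⁻¹ • (y - w)))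
      ≤ (1 - c * t⁻¹) * q (y - w) := by
    refine hq _ htinv.le ?_ _
    rw [← one_div]
    exact (one_div_le hh ht0).1 ht5
  have b1 : ‖((t⁻¹ : ℝ) : ℂ) • Q‖ ≤ t⁻¹ * (η * q (y - w)) := by
    rw [hnorm, abs_of_pos htinv]
    gcongr
    exact hlin'.trans (by gcongr; exact hq1 _)
  have b2 : ‖((l - 1 - α / t : ℝ) : ℂ) • y‖ ≤ δ / K' / 2 * t⁻¹ := by
    rw [hnorm]
    calc |l - 1 - α / t| * ‖y‖ ≤ (δ / K' / 2 / B / t) * B := by gcongr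
      _ = δ / K' / 2 * t⁻¹ := by field_simp
  have b3 : ‖(((l - 1) * t⁻¹ : ℝ) : ℂ) • P y‖ ≤ t⁻¹ * (t⁻¹ * (‖P w‖ + 1)) := by
    rw [hnorm, abs_of_nonneg (mul_nonneg (by linarith) htinv.le)]
    calc (l - 1) * t⁻¹ * ‖P y‖ ≤ t⁻¹ * t⁻¹ * (‖P w‖ + 1) := by
          gcongr
      _ = _ := by ring
  have b4 : ‖(τ : ℂ) • R‖ ≤ t⁻¹ * (2 * C * B ^ (k + 2) * s) := by
    rw [hnorm, abs_of_pos hτpos]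
    calc τ * ‖R‖ ≤ τ * (C * (s * B) ^ (k + 2)) := by gcongr
      _ = (τ * s) * s ^ k * (C * B ^ (k + 2) * s) := by rw [mul_pow, pow_add s]; ring
      _ ≤ 2 * t⁻¹ * (C * B ^ (k + 2) * s) := by
          rw [hτs, hsk]; gcongr
      _ = _ := by ring
  rw [hsplit]
  refine (map_add_le_add q _ _).trans ?_
  have b5 := (hq2' (((t⁻¹ : ℝ) : ℂ) • Q + (((l - 1 - α / t : ℝ) : ℂ) • y
          + ((((l - 1) * t⁻¹ : ℝ) : ℂ) • P y + (τ : ℂ) • R)))).trans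
    (mul_le_mul_of_nonneg_left ((norm_add_le _ _).trans (add_le_add b1 ((norm_add_le _ _).trans
      (add_le_add b2 ((norm_add_le _ _).trans (add_le_add b3 b4)))))) hK'0.le)
  have b6 : t⁻¹ * (t⁻¹ * (‖P w‖ + 1)) + t⁻¹ * (2 * C * B ^ (k + 2) * s)
      ≤ t⁻¹ * (δ / K' / 2) := by
    rw [← mul_add]; gcongr
  calc _ ≤ (1 - c * t⁻¹) * q (y - w) + K' * (t⁻¹ * (η * q (y - w)) + (δ / K' / 2 * t⁻¹
        + t⁻¹ * (δ / K' / 2))) := by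
        refine add_le_add b0 (b5.trans ?_)
        gcongr
    _ = (1 - c * t⁻¹ + K' * η * t⁻¹) * q (y - w) + δ / t := by field_simp; ring
    _ = (1 - c / 2 / t) * q (y - w) + δ / t := by rw [hηK]; ring

/-- The union of the balls `t^{-1/k} B(w, ε)` over the real parameters `t > T`. -/
def parabolicSector (q : Seminorm ℂ E) (k : ℕ) (w : E) (ε T : ℝ) : Set E :=
  {z | ∃ t > T, q (((t ^ (1 / (k : ℝ)) : ℝ) : ℂ) • z - w) < ε}

variable {q : Seminorm ℂ E} {k : ℕ} {w : E} {ε T : ℝ}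

theorem isOpen_parabolicSector (hq : Continuous q) : IsOpen (parabolicSector q k w ε T) := by
  have : parabolicSector q k w ε T
      = ⋃ t ∈ Set.Ioi T, {z | q (((t ^ (1 / (k : ℝ)) : ℝ) : ℂ) • z - w) < ε} := by
    ext z; simp [parabolicSector]
  rw [this]
  refine isOpen_biUnion fun t _ => isOpen_lt (hq.comp ?_) continuous_const
  fun_prop

theorem rpow_smul_rpow_neg_smul {t : ℝ} (ht : 0 < t) (α : ℝ) (y : E) :
    ((t ^ α : ℝ) : ℂ) • ((t ^ (-α) : ℝ) : ℂ) • y = y := by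
  rw [smul_smul, ← Complex.ofReal_mul, ← Real.rpow_add ht, add_neg_cancel, Real.rpow_zero,
    Complex.ofReal_one, one_smul]

theorem rpow_neg_smul_rpow_smul {t : ℝ} (ht : 0 < t) (α : ℝ) (y : E) :
    ((t ^ (-α) : ℝ) : ℂ) • ((t ^ α : ℝ) : ℂ) • y = y := by
  simpa using rpow_smul_rpow_neg_smul ht (-α) y

/-- The sector is the continuous image of a half-line times a convex ball under `(t, y) ↦ t^(-1/k)
y`. -/
theorem isConnected_parabolicSector (hT : 0 ≤ T) (hε : 0 < ε) :
    IsConnected (parabolicSector q k w ε T) := by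
  have himg : parabolicSector q k w ε T
      = (fun x : ℝ × E => ((x.1 ^ (-(1 / (k : ℝ))) : ℝ) : ℂ) • x.2) ''
        (Set.Ioi T ×ˢ q.ball w ε) := by
    ext z
    constructor
    · rintro ⟨t, ht, hz⟩
      exact ⟨(t, ((t ^ (1 / (k : ℝ)) : ℝ) : ℂ) • z), ⟨ht, (q.mem_ball).2 hz⟩,
        rpow_neg_smul_rpow_smul (hT.trans_lt ht) _ z⟩
    · rintro ⟨⟨t, y⟩, ⟨ht, hy⟩, rfl⟩
      refine ⟨t, ht, ?_⟩
      dsimp only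
      rw [rpow_smul_rpow_neg_smul (hT.trans_lt ht)]
      exact (q.mem_ball).1 hy
  rw [himg]
  refine IsConnected.image (IsConnected.prod isConnected_Ioi
    ⟨⟨w, q.mem_ball_self hε⟩, (q.convex_ball w ε).isPreconnected⟩) _ ?_
  refine ContinuousOn.smul (Complex.continuous_ofReal.comp_continuousOn ?_) continuousOn_snd
  exact continuousOn_fst.rpow_const fun x hx => Or.inl (hT.trans_lt hx.1).ne'

/-- The curve `t^(-1/k) w` lies in the sector and tends to `0`, while `ε ≤ q w` keeps `0` itself
outside. -/
theorem zero_mem_frontier_parabolicSector (hk : 1 ≤ k) (hT : 0 ≤ T) (hε : 0 < ε)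
    (hq : Continuous q) (hw : ε ≤ q w) : (0 : E) ∈ frontier (parabolicSector q k w ε T) := by
  rw [(isOpen_parabolicSector hq).frontier_eq]
  have hk0 : (0 : ℝ) < k := by exact_mod_cast hk
  constructor
  · have hlim : Tendsto (fun t : ℝ => ((t ^ (-(1 / (k : ℝ))) : ℝ) : ℂ) • w) atTop
        (𝓝 (((0 : ℝ) : ℂ) • w)) :=
      ((Complex.continuous_ofReal.tendsto _).comp
        (tendsto_rpow_neg_atTop (one_div_pos.2 hk0))).smul_const w
    rw [Complex.ofReal_zero, zero_smul] at hlim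
    refine mem_closure_of_tendsto hlim ?_
    filter_upwards [eventually_gt_atTop T] with t ht
    refine ⟨t, ht, ?_⟩
    rw [rpow_smul_rpow_neg_smul (hT.trans_lt ht), sub_self, map_zero]
    exact hε
  · rintro ⟨t, _, ht⟩
    rw [smul_zero, zero_sub, map_neg_eq_map] at ht
    linarith

/-- If the rescaled map contracts towards `w`, then `n^{1/k} F^n(z)` tends to `w` for `z` in an
invariant sector around the half-line spanned by `w`. -/
theorem exists_invariant_sector (hk : 1 ≤ k) {F : E → E} {c : ℝ} (hc : 0 < c) (hw : w ≠ 0)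
    (hq1 : ∀ x, ‖x‖ ≤ q x) (hq : Continuous q) (hε : 0 < ε)
    (hstep : ∀ δ > 0, ∀ᶠ t : ℝ in atTop, ∀ y, q (y - w) ≤ ε →
      q ((((t + 1) ^ (1 / (k : ℝ)) : ℝ) : ℂ) • F (((t ^ (-(1 / (k : ℝ))) : ℝ) : ℂ) • y) - w)
        ≤ (1 - c / t) * q (y - w) + δ / t)
    {U : Set E} (hU : U ∈ 𝓝 0) :
    ∃ D ⊆ U, IsOpen D ∧ IsConnected D ∧ (0 : E) ∈ frontier D ∧ Set.MapsTo F D D ∧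
      ∀ z ∈ D, Tendsto (fun n : ℕ => ((((n : ℝ) ^ (1 / (k : ℝ)) : ℝ)) : ℂ) • F^[n] z) atTop
        (𝓝 w) := by
  have hk0 : (0 : ℝ) < k := by exact_mod_cast hk
  have hα0 : (0 : ℝ) < 1 / (k : ℝ) := one_div_pos.2 hk0
  -- Lowering `c` only weakens the estimate, and `tendsto_zero_of_recursion` requires `c ≤ 1`.
  wlog hc1 : c ≤ 1 generalizing c
  · refine this one_pos (fun δ hδ => ?_) le_rfl
    filter_upwards [hstep δ hδ, eventually_gt_atTop 0] with t ht ht0 y hy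
    refine (ht y hy).trans ?_
    have : (1 - c / t) ≤ (1 - 1 / t) := by gcongr; linarith
    gcongr
  wlog hεw : ε ≤ ‖w‖ generalizing ε
  · push Not at hεw
    exact this (norm_pos_iff.2 hw)
      (fun δ hδ => (hstep δ hδ).mono fun t ht y hy => ht y (hy.trans hεw.le)) le_rfl
  set α : ℝ := 1 / (k : ℝ) with hα
  obtain ⟨r, hr, hrU⟩ := Metric.mem_nhds_iff.1 hU
  have hsr : ∀ᶠ t : ℝ in atTop, t ^ (-α) * (‖w‖ + ε) < r := by
    have : Tendsto (fun t : ℝ => t ^ (-α) * (‖w‖ + ε)) atTop (𝓝 (0 * (‖w‖ + ε))) :=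
      (tendsto_rpow_neg_atTop hα0).mul_const _
    refine this.eventually (gt_mem_nhds ?_)
    rwa [zero_mul]
  -- The error `c ε / 2` is half of what the contraction gains at radius `ε`, so the ball is mapped
  -- into itself from time `t` to time `t + 1`.
  obtain ⟨T, hT⟩ := eventually_atTop.1
    ((hsr.and (hstep (c * ε / 2) (by positivity))).and (eventually_ge_atTop 1))
  have hT1 : 1 ≤ T := (hT T le_rfl).2
  have hnext : ∀ t > T, ∀ z, q (((t ^ α : ℝ) : ℂ) • z - w) < ε →
      q ((((t + 1) ^ α : ℝ) : ℂ) • F z - w) < ε := fun t ht z hz => by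
    have ht0 : 0 < t := by linarith
    have h1 := (hT t ht.le).1.2 _ hz.le
    rw [rpow_neg_smul_rpow_smul ht0] at h1
    have h2 : 0 ≤ 1 - c / t := by
      have : c / t ≤ 1 := (div_le_one ht0).2 (by linarith)
      linarith
    have h3 : (1 - c / t) * q (((t ^ α : ℝ) : ℂ) • z - w) ≤ (1 - c / t) * ε := by gcongr
    have h4 : 0 < c * ε / 2 / t := by positivity
    have h5 : (1 - c / t) * ε + c * ε / 2 / t = ε - c * ε / 2 / t := by field_simp; ring
    linarith
  refine ⟨parabolicSector q k w ε T, ?_, isOpen_parabolicSector hq,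
    isConnected_parabolicSector (by linarith) hε,
    zero_mem_frontier_parabolicSector hk (by linarith) hε hq (hεw.trans (hq1 w)), ?_, ?_⟩
  · rintro z ⟨t, ht, hz⟩
    have ht0 : 0 < t := by linarith
    refine hrU ?_
    have h1 : ‖((t ^ α : ℝ) : ℂ) • z‖ ≤ ‖w‖ + ε := by
      have h2 := norm_add_le w (((t ^ α : ℝ) : ℂ) • z - w)
      rw [add_sub_cancel] at h2
      linarith [hq1 (((t ^ α : ℝ) : ℂ) • z - w)]
    rw [mem_ball_zero_iff, ← rpow_neg_smul_rpow_smul ht0 α z, norm_smul, Complex.norm_real,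
      Real.norm_of_nonneg (by positivity)]
    refine lt_of_le_of_lt ?_ (hT t ht.le).1.1
    gcongr
  · rintro z ⟨t, ht, hz⟩
    exact ⟨t + 1, by linarith, hnext t ht z hz⟩
  · rintro z ⟨t, ht, hz⟩
    have ht1 : 1 ≤ t := by linarith
    have htn : ∀ n : ℕ, T < t + n := fun n => by
      have : (0 : ℝ) ≤ n := n.cast_nonneg
      linarith
    have horb : ∀ n : ℕ, q ((((t + n) ^ α : ℝ) : ℂ) • F^[n] z - w) < ε := fun n => by
      induction n with
      | zero => rwa [Nat.cast_zero, add_zero]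
      | succ n ih =>
        rw [Function.iterate_succ_apply', Nat.cast_succ, ← add_assoc]
        exact hnext _ (htn n) _ ih
    have hto : Tendsto (fun n : ℕ => t + (n : ℝ)) atTop atTop :=
      tendsto_atTop_add_const_left _ _ tendsto_natCast_atTop_atTop
    have he : Tendsto (fun n : ℕ => q ((((t + n) ^ α : ℝ) : ℂ) • F^[n] z - w)) atTop (𝓝 0) := by
      refine tendsto_zero_of_recursion (fun n => apply_nonneg q _) ht1 hc hc1 fun δ hδ => ?_
      filter_upwards [hto.eventually (hstep δ hδ)] with n hn
      have h1 := hn _ (horb n).le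
      rwa [rpow_neg_smul_rpow_smul (by linarith [htn n]), add_assoc, ← Nat.cast_succ,
        ← Function.iterate_succ_apply' F n z] at h1
    have hy : Tendsto (fun n : ℕ => (((t + n) ^ α : ℝ) : ℂ) • F^[n] z) atTop (𝓝 w) := by
      rw [tendsto_iff_norm_sub_tendsto_zero]
      exact squeeze_zero (fun _ => norm_nonneg _) (fun n => hq1 _) he
    -- The starting parameter `t` depends on `z`; this ratio replaces `(t + n)^α` by `n^α`.
    have hratio : Tendsto (fun n : ℕ => ((n : ℝ) / (t + n)) ^ α) atTop (𝓝 1) := by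
      have h1 : Tendsto (fun n : ℕ => (n : ℝ) / (t + n)) atTop (𝓝 1) := by
        have h2 : Tendsto (fun n : ℕ => 1 - t / (t + n)) atTop (𝓝 (1 - 0)) :=
          tendsto_const_nhds.sub (hto.const_div_atTop t)
        rw [sub_zero] at h2
        refine h2.congr fun n => ?_
        have : t + (n : ℝ) ≠ 0 := by linarith [htn n]
        field_simp
        ring
      simpa using h1.rpow_const (p := α) (Or.inr hα0.le)
    have hprod := ((Complex.continuous_ofReal.tendsto _).comp hratio).smul hy
    rw [Complex.ofReal_one, one_smul] at hprod
    refine hprod.congr fun n => ?_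
    have hpos : 0 < t + (n : ℝ) := by linarith [htn n]
    simp only [Function.comp_apply]
    rw [smul_smul, ← Complex.ofReal_mul, ← Real.mul_rpow (by positivity) hpos.le,
      div_mul_cancel₀ _ hpos.ne']

end Dynamics

/-! ### From directors to attracted sectors, and the consequences of the limit. -/

section Assembly

variable {p k : ℕ} {F : Cp p → Cp p}

/-- The linearisation at `w = ζ v`, `ζ^k = -1 / (k lam)`, of the vector field `P_{k+1}(y) + y / k`
has eigenvalues `-1` and `-a`, with `a` a director of `[v]`. -/
theorem re_neg_of_eigenvalue {v : Cp p} (hk : 1 ≤ k) (hatt : IsAttracting F k v) {lam ζ : ℂ}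
    (hlam0 : lam ≠ 0) (hlam : homTerm F (k + 1) v = lam • v)
    (hζ : ζ ^ k = -1 / ((k : ℂ) * lam)) {μ : ℂ} {x : Cp p} (hx : x ≠ 0)
    (hμ : fderiv ℂ (homTerm F (k + 1)) (ζ • v) x + (k : ℂ)⁻¹ • x = μ • x) : μ.re < 0 := by
  have hk0 : (k : ℂ) ≠ 0 := by exact_mod_cast (by omega : k ≠ 0)
  have hζ0 : ζ ≠ 0 := by
    rintro rfl
    rw [zero_pow (by omega)] at hζ
    exact div_ne_zero (neg_ne_zero.2 one_ne_zero) (mul_ne_zero hk0 hlam0) hζ.symm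
  rw [fderiv_homTerm_smul F k hζ0, hζ] at hμ
  by_cases hxv : ∃ c : ℂ, x = c • v
  · obtain ⟨c, rfl⟩ := hxv
    rw [map_smul, fderiv_homTerm_self, hlam] at hμ
    have h1 : (-1 : ℂ) • c • v = μ • c • v := by
      rw [← hμ, smul_smul, smul_smul, smul_smul, smul_smul, smul_smul, ← add_smul]
      congr 1
      push_cast
      field_simp
      ring
    rw [← smul_left_injective ℂ hx h1]
    simp
  · push Not at hxv
    obtain ⟨j, hj, hdir⟩ := hatt
    -- Solving the eigenvalue equation for `DP(v)` gives an eigenvalue whose associated director is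
    -- `-μ`.
    have hx' : fderiv ℂ (homTerm F (k + 1)) v x = (lam - k * lam * μ) • x := by
      have h1 : (-1 / ((k : ℂ) * lam)) • fderiv ℂ (homTerm F (k + 1)) v x
          = (μ - (k : ℂ)⁻¹) • x := by
        rw [sub_smul, ← hμ, add_sub_cancel_right]
      have h2 : (-1 / ((k : ℂ) * lam)) ≠ 0 :=
        div_ne_zero (neg_ne_zero.2 one_ne_zero) (mul_ne_zero hk0 hlam0)
      refine smul_right_injective _ h2 ?_
      dsimp only
      rw [h1, smul_smul]
      congr 1
      field_simp
      ring
    have := hdir _ (mem_directors_of_eigenvector hk hj hlam0 hlam hx' hxv)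
    rw [show (lam - k * lam * μ - lam) / (k * lam) = -μ by field_simp; ring,
      Complex.neg_re] at this
    linarith

/-- The sector attracted along the real direction `ζ v`. -/
theorem exists_attracted_domain (hp : 0 < p) (hk : 1 ≤ k) (hF : IsTangentToIdentity F)
    (hord : HasOrder F (k + 1)) {v : Cp p} (hv : v ≠ 0) (hatt : IsAttracting F k v) {lam ζ : ℂ}
    (hlam0 : lam ≠ 0) (hlam : homTerm F (k + 1) v = lam • v)
    (hζ0 : ζ ≠ 0) (hζ : ζ ^ k = -1 / ((k : ℂ) * lam)) {U : Set (Cp p)} (hU : U ∈ 𝓝 0) :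
    ∃ D ⊆ U, IsOpen D ∧ IsConnected D ∧ (0 : Cp p) ∈ frontier D ∧ Set.MapsTo F D D ∧
      ∀ z ∈ D, Tendsto (fun n : ℕ => ((((n : ℝ) ^ (1 / (k : ℝ)) : ℝ)) : ℂ) • F^[n] z) atTop
        (𝓝 (ζ • v)) := by
  have hk0 : (k : ℂ) ≠ 0 := by exact_mod_cast (by omega : k ≠ 0)
  have : Nonempty (Fin p) := ⟨⟨0, hp⟩⟩
  set w := ζ • v with hw
  obtain ⟨q, K, c, h, hc, hh, hq1, hq2, hq⟩ := exists_seminorm_contracting_of_eigenvalues_re_neg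
    (fderiv ℂ (homTerm F (k + 1)) w + (k : ℂ)⁻¹ • ContinuousLinearMap.id ℂ (Cp p))
    fun μ x hx hμ => re_neg_of_eigenvalue hk hatt hlam0 hlam hζ hx (by simpa using hμ)
  have hPw : homTerm F (k + 1) w = -((k : ℂ)⁻¹ • w) := by
    rw [hw, homTerm_smul, hlam, pow_succ, hζ, smul_smul, smul_smul, ← neg_smul]
    congr 1
    field_simp
  obtain ⟨ε, hε, hstep⟩ := exists_rescaled_contraction hk (isBigO_sub_homTerm hk hF hord)
    (homTerm_smul F (k + 1)) hPw (differentiable_homTerm F (k + 1) w).hasFDerivAt hc hh hq1 hq2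
    (fun s hs hsh x => by simpa using hq s hs hsh x)
  have hqc : Continuous q := by
    refine Seminorm.continuous_of_le (q := (K.toNNReal) • normSeminorm ℂ (Cp p)) ?_ fun x => ?_
    · exact (continuous_const.mul continuous_norm :
        Continuous fun x : Cp p => (K.toNNReal : ℝ) * ‖x‖)
    · refine (hq2 x).trans ?_
      change K * ‖x‖ ≤ (K.toNNReal : ℝ) * ‖x‖
      gcongr
      exact Real.le_coe_toNNReal K
  exact exists_invariant_sector hk (half_pos hc) (smul_ne_zero hζ0 hv) hq1 hqc hε hstep hU

/-- A sequence asymptotic to `n^{-1/k} w` tends to the origin, tangentially to `[w]`. -/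
theorem isCharTrajectory_of_tendsto (hk : 1 ≤ k) {v z : Cp p} (hv : v ≠ 0) {ζ : ℂ} (hζ : ζ ≠ 0)
    (h0 : ∀ n : ℕ, F^[n] z ≠ 0)
    (h : Tendsto (fun n : ℕ => ((((n : ℝ) ^ (1 / (k : ℝ)) : ℝ)) : ℂ) • F^[n] z) atTop
      (𝓝 (ζ • v))) :
    IsCharTrajectory F (Projectivization.mk ℂ v hv) z := by
  have hk0 : (0 : ℝ) < 1 / (k : ℝ) := one_div_pos.2 (by exact_mod_cast hk)
  have hne : ∀ n : ℕ, 1 ≤ n → ((((n : ℝ) ^ (1 / (k : ℝ)) : ℝ)) : ℂ) ≠ 0 := fun n hn => by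
    have : (0 : ℝ) < n := by exact_mod_cast hn
    exact_mod_cast (Real.rpow_pos_of_pos this _).ne'
  refine ⟨?_, h0, ?_⟩
  · have h1 : Tendsto (fun n : ℕ => (((n : ℝ) ^ (-(1 / (k : ℝ))) : ℝ) : ℂ)) atTop
        (𝓝 ((0 : ℝ) : ℂ)) := (Complex.continuous_ofReal.tendsto _).comp
      ((tendsto_rpow_neg_atTop hk0).comp tendsto_natCast_atTop_atTop)
    have h2 := h1.smul h
    rw [Complex.ofReal_zero, zero_smul] at h2
    refine h2.congr' ?_
    filter_upwards [eventually_ge_atTop 1] with n hn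
    exact rpow_neg_smul_rpow_smul (by exact_mod_cast hn) _ _
  · have hζv : ζ • v ≠ 0 := smul_ne_zero hζ hv
    -- At `n = 0` the scaling factor is `0`, so the nonzero vector `v` serves as a default there.
    let y : ℕ → {w : Cp p // w ≠ 0} := fun n =>
      if hn : 1 ≤ n then ⟨_, smul_ne_zero (hne n hn) (h0 n)⟩ else ⟨v, hv⟩
    have hy : Tendsto y atTop (𝓝 ⟨ζ • v, hζv⟩) := by
      rw [tendsto_subtype_rng]
      refine h.congr' ?_
      filter_upwards [eventually_ge_atTop 1] with n hn
      simp [y, hn]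
    have hcont : Continuous fun w : {w : Cp p // w ≠ 0} => Projectivization.mk ℂ w.1 w.2 :=
      continuous_coinduced_rng
    have hlim := (hcont.tendsto ⟨ζ • v, hζv⟩).comp hy
    have hmk : Projectivization.mk ℂ (ζ • v) hζv = Projectivization.mk ℂ v hv :=
      (Projectivization.mk_eq_mk_iff' ℂ _ _ _ _).2 ⟨ζ, rfl⟩
    rw [← hmk]
    refine hlim.congr' ?_
    filter_upwards [eventually_ge_atTop 1] with n hn
    have hyn : (y n).1 = ((((n : ℝ) ^ (1 / (k : ℝ)) : ℝ)) : ℂ) • F^[n] z := by simp [y, hn]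
    exact (Projectivization.mk_eq_mk_iff' ℂ _ _ _ _).2 ⟨_, hyn.symm⟩

/-- By linearity `n · x(F^[n] z)^k = x(n^(1/k) F^[n] z)^k`, which tends to `(ζ x(v))^k = 1`. -/
theorem isEquivalent_one_div_of_tendsto (hk : 1 ≤ k) {v z : Cp p} {ζ : ℂ}
    (h : Tendsto (fun n : ℕ => ((((n : ℝ) ^ (1 / (k : ℝ)) : ℝ)) : ℂ) • F^[n] z) atTop
      (𝓝 (ζ • v)))
    (x : Cp p →ₗ[ℂ] ℂ) (hx : ζ ^ k * x v ^ k = 1) :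
    (fun n : ℕ => x (F^[n] z) ^ k) ~[atTop] (fun n : ℕ => 1 / (n : ℂ)) := by
  have hk0 : (k : ℝ) ≠ 0 := by exact_mod_cast (by omega : k ≠ 0)
  have h1 := ((x.continuous_of_finiteDimensional.tendsto (ζ • v)).comp h).pow k
  rw [map_smul, smul_eq_mul, mul_pow, hx] at h1
  rw [isEquivalent_iff_tendsto_one]
  · refine h1.congr fun n => ?_
    have h2 : ((((n : ℝ) ^ (1 / (k : ℝ)) : ℝ)) : ℂ) ^ k = n := by
      rw [← Complex.ofReal_pow, ← Real.rpow_natCast, ← Real.rpow_mul n.cast_nonneg,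
        one_div_mul_cancel hk0, Real.rpow_one, Complex.ofReal_natCast]
    simp only [Function.comp_apply, map_smul, smul_eq_mul, Pi.div_apply, mul_pow, h2]
    rw [div_div_eq_mul_div, div_one, mul_comm]
  · filter_upwards [eventually_gt_atTop 0] with n hn
    exact one_div_ne_zero (by exact_mod_cast hn.ne')

theorem exists_injective_pow_eq (hk : 1 ≤ k) {a : ℂ} (ha : a ≠ 0) :
    ∃ ζ : Fin k → ℂ, Function.Injective ζ ∧ ∀ i, ζ i ^ k = a := by
  obtain ⟨b, hb⟩ := IsAlgClosed.exists_pow_nat_eq a (Nat.pos_of_ne_zero (by omega : k ≠ 0))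
  have hb0 : b ≠ 0 := by
    rintro rfl
    exact ha (by rw [← hb, zero_pow (by omega)])
  have hω := Complex.isPrimitiveRoot_exp k (by omega)
  refine ⟨fun i => b * Complex.exp (2 * Real.pi * Complex.I / k) ^ (i : ℕ), fun i j hij => ?_,
    fun i => ?_⟩
  · exact Fin.ext (hω.pow_inj i.2 j.2 (mul_left_cancel₀ hb0 hij))
  · rw [mul_pow, hb, ← pow_mul, mul_comm, mul_comm (i : ℕ), pow_mul, hω.pow_eq_one, one_pow,
      one_mul]

end Assembly

end ParabolicGerm

end

/-- The representative `F` being arbitrary, the domains are asserted to exist inside any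
given neighbourhood `U` of the origin. A linear coordinate `x` is normalised when
`x(v)^k = -k lam`, which makes the first component of the germ, restricted to the line of
`v`, equal to `x - x^(k+1)/k + ⋯`. The last clause says that the `k` domains belong to the
`k` different real attracting directions `ζ i • v`. -/
theorem theorem7p1 (p k : ℕ) (hp : 2 ≤ p) (hk : 1 ≤ k)
    (F : ParabolicGerm.Cp p → ParabolicGerm.Cp p)
    (hF : ParabolicGerm.IsTangentToIdentity F)
    (hord : ParabolicGerm.HasOrder F (k + 1))
    (v : ParabolicGerm.Cp p) (hv : ParabolicGerm.IsNondegCharDirection F k v)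
    (hatt : ParabolicGerm.IsAttracting F k v)
    (lam : ℂ) (hlam : ParabolicGerm.homTerm F (k + 1) v = lam • v)
    (U : Set (ParabolicGerm.Cp p)) (hU : U ∈ 𝓝 (0 : ParabolicGerm.Cp p)) :
    ∃ (D : Fin k → Set (ParabolicGerm.Cp p)) (ζ : Fin k → ℂ),
      (∀ i, D i ⊆ U) ∧
      (∀ i, ParabolicGerm.IsParabolicDomain F (Projectivization.mk ℂ v hv.ne_zero) (D i)) ∧
      (∀ i j, i ≠ j → Disjoint (D i) (D j)) ∧
      (∀ i, ∀ z ∈ D i, ∀ x : ParabolicGerm.Cp p →ₗ[ℂ] ℂ, x v ^ k = -((k : ℂ) * lam) →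
        (fun n : ℕ => x (F^[n] z) ^ k) ~[atTop] (fun n : ℕ => 1 / (n : ℂ))) ∧
      Function.Injective ζ ∧
      (∀ i, ζ i ^ k = -1 / ((k : ℂ) * lam)) ∧
      (∀ i, ∀ z ∈ D i,
        Tendsto (fun n : ℕ => ((((n : ℝ) ^ (1 / (k : ℝ)) : ℝ)) : ℂ) • F^[n] z) atTop
          (𝓝 (ζ i • v))) := by
  have hk0 : (k : ℂ) ≠ 0 := by exact_mod_cast (by omega : k ≠ 0)
  have hlam0 : lam ≠ 0 := by
    rintro rfl
    exact hv.nondegenerate (by rw [hlam, zero_smul])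
  have hkl : (k : ℂ) * lam ≠ 0 := mul_ne_zero hk0 hlam0
  have ha : -1 / ((k : ℂ) * lam) ≠ 0 := div_ne_zero (neg_ne_zero.2 one_ne_zero) hkl
  obtain ⟨ζ, hinj, hζ⟩ := ParabolicGerm.exists_injective_pow_eq hk ha
  have hζ0 : ∀ i, ζ i ≠ 0 := fun i h => ha (by rw [← hζ i, h, zero_pow (by omega)])
  choose D hDU hDo hDc hDf hDm hD using fun i => ParabolicGerm.exists_attracted_domain
    (by omega) hk hF hord hv.ne_zero hatt hlam0 hlam (hζ0 i) (hζ i) hU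
  -- An open set misses its frontier, so `0` is not in the invariant set `D i`.
  have horb : ∀ i, ∀ z ∈ D i, ∀ n : ℕ, F^[n] z ≠ 0 := fun i z hz n h0 => by
    have hmem : F^[n] z ∈ D i := (hDm i).iterate n hz
    rw [h0] at hmem
    have hfr := hDf i
    rw [(hDo i).frontier_eq] at hfr
    exact hfr.2 hmem
  refine ⟨D, ζ, hDU, fun i => ⟨hDo i, hDc i, hDf i, hDm i, fun z hz =>
    ParabolicGerm.isCharTrajectory_of_tendsto hk hv.ne_zero (hζ0 i) (horb i z hz) (hD i z hz)⟩,
    fun i j hij => ?_, fun i z hz x hx => ?_, hinj, hζ, hD⟩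
  -- A common point would have both `ζ i • v` and `ζ j • v` as the limit of its rescaled orbit.
  · refine Set.disjoint_left.2 fun z hi hj => hij (hinj ?_)
    exact smul_left_injective ℂ hv.ne_zero (tendsto_nhds_unique (hD i z hi) (hD j z hj))
  · refine ParabolicGerm.isEquivalent_one_div_of_tendsto hk (hD i z hz) x ?_
    rw [hζ i, hx]
    field_simp
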